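/- A \emph{bidirected graph} $B$ is a finite loopless multigraph with vertex set $V(B)$ and edge set $E(B)$ together with a sign $\sigma(e,u)\in\{+,-\}$ for every edge $e$ and endpoint $u$ of $e$. A \emph{trail} from $v_0$ to $v_\ell$ is a sequence $v_0\vec e_1v_1\vec e_2\dots\vec e_\ell v_\ell$ $(\ell\ge 0)$ in which $\vec e_i$ is an orientation of an edge $e_i$ with tail $v_{i-1}$ and head $v_i$, the edges $e_1,\dots,e_\ell$ are pairwise distinct, and $\sigma(e_{i+1},v_i)=-\sigma(e_i,v_i)$ for $1\le i<\ell$. A \emph{path} is a trail that does not repeat vertices. Trails are \emph{edge-disjoint} if no edge lies on two of them. Fix a root $r\in V(B)$. An $r$\emph{-trail} is a trail that starts in $r$ and has no internal vertex equal to $r$ (it may end in $r$). An edge $e$ is \emph{trail-undirectable} if each of its two orientations is the last oriented edge of some $r$-trail. The rooted bidirected graph $B$ is \emph{edge-clean} if $r$ lies in no nontrivial component of the subgraph formed by the trail-undirectable edges, i.e. if $r$ is not an endpoint of a trail-undirectable edge. For $X\subseteq V(B)\setminus\{r\}$ let $\delta^{\mathsf{path}}_{r,B}(X)$ be the set of edges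 $e$ that have an orientation $\vec e$ with head in $X$ and tail not in $X$ such that some path starting in $r$ has $\vec e$ as its last oriented edge. \textbf{Theorem.} Let $B$ be an edge-clean bidirected graph rooted at $r$ and let $x\in V(B)\setminus\{r\}$. Then the maximum number $\lambda_B^{\mathrm{path}}(r,x)$ of pairwise edge-disjoint $r$--$x$ paths in $B$ satisfies \[\lambda_B^{\mathrm{path}}(r,x)=\min\left\{\left|\delta^{\mathsf{path}}_{r,B}(X)\right| : x\in X\subseteq V(B)\setminus\{r\}\right\}.\] Moreover, the maximum number of pairwise edge-disjoint $r$--$x$ paths (respectively, $r$--$x$ trails) in $B$ equals the minimum size of an edge set $F\subseteq E(B)$ such that $B-F$ contains no $r$--$x$ path (respectively, no $r$--$x$ trail). -/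

import Mathlib

universe u v

/-- A bidirected graph with vertex set `V` and edge set `E`: a loopless multigraph in which every
half-edge `(e, u)` (with `u` an endpoint of `e`) carries a sign `+1` or `-1`.
The value `sign e u` is only ever used when `u` is an endpoint of `e`. -/
structure BidirectedGraph (V : Type u) (E : Type v) where
  /-- the pair of endpoints of an edge -/
  ends : E → Sym2 V
  /-- no edge is a loop -/
  loopless : ∀ e, ¬ (ends e).IsDiag
  /-- the signing of the half-edges -/
  sign : E → V → ℤˣ

namespace BidirectedGraph

variable {V : Type u} {E : Type v}

/-- An edge together with one of its two orientations. -/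
structure OrientedEdge (B : BidirectedGraph V E) where
  edge : E
  tail : V
  head : V
  ends_eq : B.ends edge = s(tail, head)

/-- The oriented edges `l` fit together to a walk from `x` to `y`: the first tail is `x`, the last
head is `y`, and each head is the next tail. The empty list is a walk from `x` to `x`. -/
def Joins (B : BidirectedGraph V E) : V → List B.OrientedEdge → V → Prop
  | x, [], y => x = y
  | x, a :: l, y => a.tail = x ∧ Joins B a.head l y

/-- An `x`–`y` trail: no edge is repeated (in either orientation), and at every
internal vertex of the sequence the arriving and the leaving edge have opposite signs. -/
structure Trail (B : BidirectedGraph V E) (x y : V) where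
  steps : List B.OrientedEdge
  joins : B.Joins x steps y
  edges_nodup : (steps.map OrientedEdge.edge).Nodup
  alternating : steps.IsChain
    (fun a b => B.sign b.edge b.tail = - B.sign a.edge a.head)

namespace Trail

variable {B : BidirectedGraph V E} {x y : V}

/-- The set of underlying edges of a trail. -/
def edgeSet (T : B.Trail x y) : Set E := {e | e ∈ T.steps.map OrientedEdge.edge}

/-- The sequence `v₀, v₁, …, v_ℓ` of vertices of a trail. -/
def vertices (T : B.Trail x y) : List V := x :: T.steps.map OrientedEdge.head

/-- A path is a trail that does not repeat vertices. -/
def IsPath (T : B.Trail x y) : Prop := T.vertices.Nodup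

/-- For a trail starting in `x`: no internal vertex `v₁, …, v_{ℓ-1}` equals `x`. With `x = r` the
root, such trails are the `r`-trails; they may end in `r`. -/
def IsRootTrail (T : B.Trail x y) : Prop := x ∉ (T.steps.map OrientedEdge.head).dropLast

/-- The last oriented edge of the trail is `a`. -/
def EndsWith (T : B.Trail x y) (a : B.OrientedEdge) : Prop := T.steps.getLast? = some a

end Trail

variable (B : BidirectedGraph V E) (r : V)

/-- There is an `r`-trail with terminal oriented edge `a`. -/
def TrailReaches (a : B.OrientedEdge) : Prop :=
  ∃ T : B.Trail r a.head, T.IsRootTrail ∧ T.EndsWith a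

/-- There is an `r`-path with terminal oriented edge `a`. -/
def PathReaches (a : B.OrientedEdge) : Prop :=
  ∃ T : B.Trail r a.head, T.IsPath ∧ T.EndsWith a

/-- An edge is trail-undirectable if both its orientations are terminal edges of `r`-trails. -/
def TrailUndirectable (e : E) : Prop :=
  ∀ a : B.OrientedEdge, a.edge = e → B.TrailReaches r a

/-- `B` rooted at `r` is edge-clean if `r` lies in no trail-undirectable component, that is, in no
nontrivial component of the subgraph formed by the trail-undirectable edges; the vertices of these
components are exactly the endpoints of trail-undirectable edges. -/
def EdgeClean : Prop := ∀ e, B.TrailUndirectable r e → r ∉ B.ends e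

/-- `δ^path_{r,B}(X)`: the edges with an orientation that enters `X` and is the terminal edge of an
`r`-path. -/
def pathCut (X : Set V) : Set E :=
  {e | ∃ a : B.OrientedEdge, a.edge = e ∧ a.head ∈ X ∧ a.tail ∉ X ∧ B.PathReaches r a}

/-- The sizes of the finite families of pairwise edge-disjoint `r`–`x` trails. -/
def trailPackingSizes (x : V) : Set ℕ :=
  {k | ∃ P : Finset (B.Trail r x),
    (P : Set (B.Trail r x)).Pairwise (fun S T => Disjoint S.edgeSet T.edgeSet) ∧ P.card = k}

/-- The sizes of the finite families of pairwise edge-disjoint `r`–`x` paths. -/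
def pathPackingSizes (x : V) : Set ℕ :=
  {k | ∃ P : Finset (B.Trail r x), (∀ T ∈ P, T.IsPath) ∧
    (P : Set (B.Trail r x)).Pairwise (fun S T => Disjoint S.edgeSet T.edgeSet) ∧ P.card = k}

/-- The bidirected graph `B - F`. -/
def deleteEdges (F : Set E) : BidirectedGraph V {e : E // e ∉ F} where
  ends e := B.ends e
  loopless e := B.loopless e
  sign e := B.sign e

end BidirectedGraph

/-!
Consider the edges that trails from `r` traverse in both directions, and call the nontrivial
components of the subgraph they form blossoms. If `B` is edge-clean, then no trail returns to `r`,
so `r` lies in no blossom. A blossom has exactly one entrance: an edge that trails from `r` traverse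
only towards the blossom, that every such trail to the blossom uses, and after which a trail ending
in the blossom stays inside. Moreover, a vertex of a blossom is reached with both signs, while all
trails from `r` to a vertex outside the blossoms arrive with the same sign.

Contracting the blossoms and keeping the edges that are traversed in one direction only yields a
directed multigraph, to which Menger's theorem applies. A directed path in it lifts to a trail in
`B`: outside the blossoms the signs match automatically, and inside a blossom any required sign can
be realised. Since the entrance determines the blossom, lifts of arc-disjoint directed paths are
edge-disjoint. Paths and trails are treated together as the trails that visit no vertex of a given
set `S` twice, where `S` is everything or empty.
-/

/-! ### Arc-disjoint directed paths -/

section Digraph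

open Finset

variable {D W : Type*}

/-- In the directed multigraph with arc set `D`, tails `tl` and heads `hd`, the list `l` of arcs is
a directed walk from `x` to `y`. -/
def IsDiwalk (tl hd : D → W) : W → List D → W → Prop
  | x, [], y => x = y
  | x, a :: l, y => tl a = x ∧ IsDiwalk tl hd (hd a) l y

/-- The list `l` of arcs from `A` is a directed path from `x` to `y`, that is, a directed walk that
visits no vertex twice. -/
structure IsDipath (tl hd : D → W) (A : Set D) (x : W) (l : List D) (y : W) : Prop where
  walk : IsDiwalk tl hd x l y
  nodup : (x :: l.map hd).Nodup
  mem : ∀ d ∈ l, d ∈ A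

/-- The arc set `J ⊆ A` is a flow of value `k` from `s` to `t` in which every arc has capacity `1`.
The conservation law is tested against arbitrary potentials `p`; for the indicator function of a
vertex it says that in- and outflow balance there, for that of a set it computes the flow out of
the set. -/
structure IsUnitFlow (tl hd : D → W) (A : Set D) (s t : W) (k : ℕ) (J : Finset D) : Prop where
  subset : (J : Set D) ⊆ A
  sum_eq : ∀ p : W → ℤ, ∑ d ∈ J, (p (tl d) - p (hd d)) = k * (p s - p t)

variable {tl hd : D → W} {A : Set D} {s t x y : W} {l l₁ l₂ : List D} {d : D} {k : ℕ}
  {J : Finset D}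

namespace IsDiwalk

theorem append_iff :
    IsDiwalk tl hd x (l₁ ++ l₂) y ↔ ∃ z, IsDiwalk tl hd x l₁ z ∧ IsDiwalk tl hd z l₂ y := by
  induction l₁ generalizing x with
  | nil => simp [IsDiwalk]
  | cons a l ih => simp [IsDiwalk, ih, and_assoc]

theorem append_cons_iff :
    IsDiwalk tl hd x (l₁ ++ d :: l₂) y ↔
      IsDiwalk tl hd x l₁ (tl d) ∧ IsDiwalk tl hd (hd d) l₂ y := by
  simp only [append_iff, IsDiwalk]
  grind

theorem concat_iff :
    IsDiwalk tl hd x (l ++ [d]) y ↔ IsDiwalk tl hd x l (tl d) ∧ hd d = y :=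
  append_cons_iff

theorem map_iff {D' : Type*} {g : D' → D} {l : List D'} :
    IsDiwalk tl hd x (l.map g) y ↔ IsDiwalk (tl ∘ g) (hd ∘ g) x l y := by
  induction l generalizing x with
  | nil => rfl
  | cons a l ih => simp [IsDiwalk, ih]

theorem sum_potential (h : IsDiwalk tl hd x l y) (p : W → ℤ) :
    (l.map fun d => p (tl d) - p (hd d)).sum = p x - p y := by
  induction l generalizing x with
  | nil => cases h; simp
  | cons a l ih =>
    obtain ⟨rfl, h⟩ := h
    simp [ih h]

theorem exists_isDipath (h : IsDiwalk tl hd x l y) (hA : ∀ d ∈ l, d ∈ A) :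
    ∃ l', IsDipath tl hd A x l' y := by
  induction l generalizing x with
  | nil => exact ⟨[], h, by simp, by simp⟩
  | cons a l ih =>
    obtain ⟨rfl, h⟩ := h
    obtain ⟨l', hw, hn, hl'⟩ := ih h fun d hdl => hA d (List.mem_cons_of_mem a hdl)
    by_cases hx : tl a ∈ hd a :: l'.map hd
    · rcases List.mem_cons.1 hx with hx | hx
      · exact ⟨l', hx ▸ hw, hx ▸ hn, hl'⟩
      · obtain ⟨b, hb, hbx⟩ := List.mem_map.1 hx
        obtain ⟨l₁, l₂, rfl⟩ := List.append_of_mem hb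
        refine ⟨l₂, hbx ▸ (append_cons_iff.1 hw).2, hn.sublist ?_, fun d hdl => hl' d ?_⟩
        · simp [← hbx]
        · simp [hdl]
    · exact ⟨a :: l', ⟨rfl, hw⟩, List.nodup_cons.2 ⟨hx, hn⟩,
        List.forall_mem_cons.2 ⟨hA a List.mem_cons_self, hl'⟩⟩

end IsDiwalk

theorem IsDipath.sum_potential [DecidableEq D] (h : IsDipath tl hd A x l y) (p : W → ℤ) :
    ∑ d ∈ l.toFinset, (p (tl d) - p (hd d)) = p x - p y := by
  rw [List.sum_toFinset _ (List.Nodup.of_map _ (List.nodup_cons.1 h.nodup).2)]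
  exact h.walk.sum_potential p

variable (tl hd A s t) in
theorem exists_isDipath_or_exists_closed_cut :
    (∃ l, IsDipath tl hd A s l t) ∨ ∃ X : Set W, t ∈ X ∧ s ∉ X ∧ ∀ d ∈ A, hd d ∈ X → tl d ∈ X := by
  by_contra! ⟨hpath, hcut⟩
  obtain ⟨d, hdA, hhead, htail⟩ :=
    hcut {v | ¬ ∃ l, IsDiwalk tl hd s l v ∧ ∀ d ∈ l, d ∈ A}
      (fun ⟨l, hw, hl⟩ => (hw.exists_isDipath hl).elim hpath)
      (not_not.2 ⟨[], rfl, by simp⟩)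
  obtain ⟨l, hw, hl⟩ := not_not.1 htail
  exact hhead ⟨l ++ [d], IsDiwalk.concat_iff.2 ⟨hw, rfl⟩, by grind⟩

namespace IsUnitFlow

theorem exists_isDipath (h : IsUnitFlow tl hd A s t (k + 1) J) :
    ∃ l, IsDipath tl hd J s l t := by
  classical
  refine (exists_isDipath_or_exists_closed_cut tl hd J s t).resolve_right ?_
  rintro ⟨X, htX, hsX, hX⟩
  have hnonpos : ∑ d ∈ J, (Xᶜ.indicator 1 (tl d) - Xᶜ.indicator 1 (hd d) : ℤ) ≤ 0 :=
    sum_nonpos fun d hdJ => by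
      have := hX d hdJ
      simp only [Set.indicator_apply, Set.mem_compl_iff, Pi.one_apply]
      grind
  rw [h.sum_eq] at hnonpos
  have hk : (k : ℤ) + 1 ≤ 0 := by simpa [htX, hsX] using hnonpos
  omega

theorem sdiff [DecidableEq D] (h : IsUnitFlow tl hd A s t (k + 1) J)
    (hl : IsDipath tl hd J s l t) : IsUnitFlow tl hd A s t k (J \ l.toFinset) where
  subset := subset_trans (coe_subset.2 sdiff_subset) h.subset
  sum_eq p := by
    have hsub : l.toFinset ⊆ J := fun d hdl => hl.mem d (List.mem_toFinset.1 hdl)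
    have hsplit := sum_sdiff (f := fun d => p (tl d) - p (hd d)) hsub
    rw [hl.sum_potential, h.sum_eq] at hsplit
    push_cast at hsplit
    linarith

theorem exists_pairwise_disjoint_isDipath (h : IsUnitFlow tl hd A s t k J) :
    ∃ f : Fin k → List D, (∀ i, IsDipath tl hd A s (f i) t) ∧
      Pairwise fun i j => (f i).Disjoint (f j) := by
  classical
  suffices ∃ f : Fin k → List D, (∀ i, IsDipath tl hd J s (f i) t) ∧
      Pairwise fun i j => (f i).Disjoint (f j) from
    this.imp fun f hf =>
      ⟨fun i => ⟨(hf.1 i).walk, (hf.1 i).nodup, fun d hdf => h.subset ((hf.1 i).mem d hdf)⟩, hf.2⟩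
  induction k generalizing J with
  | zero => exact ⟨Fin.elim0, fun i => i.elim0, fun i => i.elim0⟩
  | succ k ih =>
    obtain ⟨l, hl⟩ := h.exists_isDipath
    obtain ⟨f, hf, hdisj⟩ := ih (h.sdiff hl)
    have hlf : ∀ i, l.Disjoint (f i) := fun i d hdl hdi => by
      simpa [hdl] using (hf i).mem d hdi
    have hfJ : ∀ i, IsDipath tl hd J s (f i) t := fun i =>
      ⟨(hf i).walk, (hf i).nodup, fun d hdf => sdiff_subset ((hf i).mem d hdf)⟩
    exact ⟨Fin.cons l f, fun i => Fin.cases hl hfJ i,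
      pairwise_fin_succ_iff.2 ⟨fun i => (hlf i).symm, hlf, hdisj⟩⟩

/-- An arc of the flow is traversed backwards in the residual graph, hence the exchanged tails and
heads on `J`. -/
theorem augment [DecidableEq D] (h : IsUnitFlow tl hd A s t k J)
    (hl : IsDipath (J.piecewise hd tl) (J.piecewise tl hd) A s l t) :
    IsUnitFlow tl hd A s t (k + 1) (symmDiff J l.toFinset) where
  subset d hmem := by
    rcases mem_symmDiff.1 hmem with ⟨hdJ, -⟩ | ⟨hdl, -⟩
    exacts [h.subset hdJ, hl.mem d (List.mem_toFinset.1 hdl)]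
  sum_eq p := by
    have hpath := hl.sum_potential p
    set c : D → ℤ := fun d => p (tl d) - p (hd d) with hc
    have hforward : ∑ d ∈ l.toFinset \ J,
        (p (J.piecewise hd tl d) - p (J.piecewise tl hd d)) = ∑ d ∈ l.toFinset \ J, c d :=
      sum_congr rfl fun d hmem => by simp [(mem_sdiff.1 hmem).2, hc]
    have hbackward : ∑ d ∈ l.toFinset ∩ J,
        (p (J.piecewise hd tl d) - p (J.piecewise tl hd d)) = -∑ d ∈ J ∩ l.toFinset, c d := by
      rw [inter_comm, ← sum_neg_distrib]
      exact sum_congr rfl fun d hmem => by simp [(mem_inter.1 hmem).1, hc]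
    rw [← sum_inter_add_sum_sdiff _ J, hforward, hbackward] at hpath
    have hJ := sum_inter_add_sum_sdiff J l.toFinset c
    rw [h.sum_eq] at hJ
    rw [symmDiff_def, sup_eq_union, sum_union disjoint_sdiff_sdiff]
    push_cast
    linarith

theorem ncard_eq_of_residual_closed [DecidableEq D] (h : IsUnitFlow tl hd A s t k J) {X : Set W}
    (htX : t ∈ X) (hsX : s ∉ X)
    (hX : ∀ d ∈ A, J.piecewise tl hd d ∈ X → J.piecewise hd tl d ∈ X) :
    {d ∈ A | tl d ∉ X ∧ hd d ∈ X}.ncard = k := by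
  classical
  have hcut : {d ∈ A | tl d ∉ X ∧ hd d ∈ X} = ↑{d ∈ J | tl d ∉ X ∧ hd d ∈ X} := by
    ext d
    have := hX d
    have := @h.subset d
    simp only [piecewise, mem_coe, coe_filter, Set.mem_ofPred_eq] at *
    grind
  have hterm : ∀ d ∈ J, (Xᶜ.indicator 1 (tl d) - Xᶜ.indicator 1 (hd d) : ℤ) =
      if tl d ∉ X ∧ hd d ∈ X then 1 else 0 := fun d hdJ => by
    have := hX d (h.subset hdJ)
    simp only [piecewise, hdJ, if_true] at this
    simp only [Set.indicator_apply, Set.mem_compl_iff, Pi.one_apply]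
    grind
  have hsum := h.sum_eq (Xᶜ.indicator 1)
  rw [sum_congr rfl hterm, sum_boole] at hsum
  rw [hcut, Set.ncard_coe_finset]
  simpa [htX, hsX] using hsum

theorem augment_or_exists_cut (h : IsUnitFlow tl hd A s t k J) :
    (∃ J', IsUnitFlow tl hd A s t (k + 1) J') ∨
      ∃ X : Set W, t ∈ X ∧ s ∉ X ∧ {d ∈ A | tl d ∉ X ∧ hd d ∈ X}.ncard = k := by
  classical
  rcases exists_isDipath_or_exists_closed_cut (J.piecewise hd tl) (J.piecewise tl hd) A s t with
    ⟨l, hl⟩ | ⟨X, htX, hsX, hX⟩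
  · exact .inl ⟨_, h.augment hl⟩
  · exact .inr ⟨X, htX, hsX, h.ncard_eq_of_residual_closed htX hsX hX⟩

theorem le_ncard (h : IsUnitFlow tl hd A s t k J) (hA : A.Finite) (hst : s ≠ t) :
    k ≤ A.ncard := by
  classical
  have hle : ∑ d ∈ J, (({s} : Set W).indicator 1 (tl d) - ({s} : Set W).indicator 1 (hd d) : ℤ) ≤
      ∑ d ∈ J, 1 :=
    sum_le_sum fun d _ => by
      simp only [Set.indicator_apply, Pi.one_apply]
      grind
  rw [h.sum_eq] at hle
  have hk : k ≤ #J := by simpa [hst.symm] using hle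
  exact hk.trans (Set.ncard_coe_finset J ▸ Set.ncard_le_ncard h.subset hA)

end IsUnitFlow

variable (tl hd) in
/-- **Menger's theorem** for arc-disjoint directed paths, in the form that asserts only the
existence of a packing and a cut of equal size. -/
theorem exists_pairwise_disjoint_isDipath_and_cut (hA : A.Finite) (hst : s ≠ t) :
    ∃ (k : ℕ) (f : Fin k → List D) (X : Set W), (∀ i, IsDipath tl hd A s (f i) t) ∧
      (Pairwise fun i j => (f i).Disjoint (f j)) ∧
      t ∈ X ∧ s ∉ X ∧ {d ∈ A | tl d ∉ X ∧ hd d ∈ X}.ncard = k := by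
  by_contra hnone
  have hflow : ∀ k, ∃ J, IsUnitFlow tl hd A s t k J := by
    intro k
    induction k with
    | zero => exact ⟨∅, by simp, by simp⟩
    | succ k ih =>
      obtain ⟨J, hJ⟩ := ih
      refine hJ.augment_or_exists_cut.resolve_right fun ⟨X, hX⟩ => hnone ?_
      obtain ⟨f, hf, hdisj⟩ := hJ.exists_pairwise_disjoint_isDipath
      exact ⟨k, f, X, hf, hdisj, hX⟩
  obtain ⟨J, hJ⟩ := hflow (A.ncard + 1)
  exact absurd (hJ.le_ncard hA hst) (by omega)

end Digraph

/-! ### Trails as lists of oriented edges -/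

namespace BidirectedGraph

variable {V : Type u} {E : Type v} {B : BidirectedGraph V E}

namespace OrientedEdge

variable {a b : B.OrientedEdge}

/-- The same edge with the opposite orientation. -/
def rev (a : B.OrientedEdge) : B.OrientedEdge :=
  ⟨a.edge, a.head, a.tail, a.ends_eq.trans Sym2.eq_swap⟩

@[simp] theorem edge_rev : a.rev.edge = a.edge := rfl

theorem edge_eq_edge_iff : a.edge = b.edge ↔ a = b ∨ a = b.rev := by
  refine ⟨fun h => ?_, by rintro (rfl | rfl) <;> rfl⟩
  obtain ⟨e, t, u, ha⟩ := a
  obtain ⟨e', t', u', hb⟩ := b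
  obtain rfl : e = e' := h
  rcases Sym2.eq_iff.1 (ha.symm.trans hb) with ⟨rfl, rfl⟩ | ⟨rfl, rfl⟩
  · exact .inl rfl
  · exact .inr rfl

/-- The sign of an oriented edge at its head. -/
def headSign (a : B.OrientedEdge) : ℤˣ := B.sign a.edge a.head

/-- The sign of an oriented edge at its tail. -/
def tailSign (a : B.OrientedEdge) : ℤˣ := B.sign a.edge a.tail

@[simp] theorem headSign_rev : a.rev.headSign = a.tailSign := rfl
@[simp] theorem tailSign_rev : a.rev.tailSign = a.headSign := rfl

instance [Finite E] : Finite B.OrientedEdge :=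
  Set.finite_univ_iff.1 <| (Set.toFinite _).of_finite_fibers edge fun e _ => by
    rcases (Set.univ ∩ edge ⁻¹' {e} : Set B.OrientedEdge).eq_empty_or_nonempty with he | ⟨a, -, rfl⟩
    · exact he ▸ Set.finite_empty
    · exact (Set.toFinite {a, a.rev}).subset fun b hb => edge_eq_edge_iff.1 hb.2

end OrientedEdge

open OrientedEdge

/-- The oriented edges `l` are the steps of a trail from `x` to `y`. This is `Trail` with the list
of steps as a parameter. -/
structure IsTrail (B : BidirectedGraph V E) (x : V) (l : List B.OrientedEdge) (y : V) : Prop where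
  walk : IsDiwalk tail head x l y
  nodup : (l.map edge).Nodup
  chain : l.IsChain fun a b => b.tailSign = -a.headSign

/-- The sign of the last step at its head, if there is a step. -/
def arrivalSign (l : List B.OrientedEdge) : Option ℤˣ := l.getLast?.map headSign

/-- The sign of the first step at its tail, if there is a step. -/
def departureSign (l : List B.OrientedEdge) : Option ℤˣ := l.head?.map tailSign

/-- The steps of the reversed trail. -/
def revSteps (l : List B.OrientedEdge) : List B.OrientedEdge := (l.map rev).reverse

section Steps

variable {l l₁ l₂ : List B.OrientedEdge} {a : B.OrientedEdge}

@[simp] theorem arrivalSign_append_cons : arrivalSign (l₁ ++ a :: l₂) = arrivalSign (a :: l₂) := by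
  rw [arrivalSign, List.getLast?_append_cons, arrivalSign]

@[simp] theorem arrivalSign_singleton : arrivalSign [a] = some a.headSign := rfl

@[simp] theorem departureSign_cons : departureSign (a :: l) = some a.tailSign := rfl

@[simp] theorem arrivalSign_revSteps : arrivalSign (revSteps l) = departureSign l := by
  simp [arrivalSign, departureSign, revSteps, Function.comp_def]

@[simp] theorem departureSign_revSteps : departureSign (revSteps l) = arrivalSign l := by
  simp [arrivalSign, departureSign, revSteps, Function.comp_def]

@[simp] theorem map_edge_revSteps : (revSteps l).map edge = (l.map edge).reverse := by
  simp [revSteps, Function.comp_def]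

@[simp] theorem mem_revSteps : a ∈ revSteps l ↔ a.rev ∈ l := by
  simp only [revSteps, List.mem_reverse, List.mem_map]
  exact ⟨by rintro ⟨b, hb, rfl⟩; exact hb, fun h => ⟨a.rev, h, rfl⟩⟩

end Steps

namespace IsTrail

variable {x y z w r v : V} {l l₁ l₂ T Q : List B.OrientedEdge} {a q : B.OrientedEdge}

theorem singleton : B.IsTrail a.tail [a] a.head := ⟨⟨rfl, rfl⟩, by simp, by simp⟩

theorem append_iff :
    B.IsTrail x (l₁ ++ l₂) z ↔ ∃ y, B.IsTrail x l₁ y ∧ B.IsTrail y l₂ z ∧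
      (l₁.map edge).Disjoint (l₂.map edge) ∧
      ∀ s ∈ arrivalSign l₁, ∀ t ∈ departureSign l₂, t = -s := by
  have hsign : (∀ s ∈ arrivalSign l₁, ∀ t ∈ departureSign l₂, t = -s) ↔
      ∀ a ∈ l₁.getLast?, ∀ b ∈ l₂.head?, b.tailSign = -a.headSign := by
    simp [arrivalSign, departureSign]
  rw [hsign]
  constructor
  · rintro ⟨hw, hn, hc⟩
    obtain ⟨y, hw₁, hw₂⟩ := IsDiwalk.append_iff.1 hw
    rw [List.map_append, List.nodup_append'] at hn
    obtain ⟨hc₁, hc₂, hc⟩ := List.isChain_append.1 hc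
    exact ⟨y, ⟨hw₁, hn.1, hc₁⟩, ⟨hw₂, hn.2.1, hc₂⟩, hn.2.2, hc⟩
  · rintro ⟨y, h₁, h₂, hdisj, hc⟩
    refine ⟨IsDiwalk.append_iff.2 ⟨y, h₁.walk, h₂.walk⟩, ?_,
      List.isChain_append.2 ⟨h₁.chain, h₂.chain, hc⟩⟩
    rw [List.map_append, List.nodup_append']
    exact ⟨h₁.nodup, h₂.nodup, hdisj⟩

theorem append_cons_iff :
    B.IsTrail x (l₁ ++ a :: l₂) y ↔ B.IsTrail x l₁ a.tail ∧ B.IsTrail a.tail (a :: l₂) y ∧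
      (l₁.map edge).Disjoint ((a :: l₂).map edge) ∧ ∀ s ∈ arrivalSign l₁, a.tailSign = -s := by
  rw [append_iff]
  constructor
  · rintro ⟨z, h₁, h₂, hdisj, hsign⟩
    obtain rfl := h₂.walk.1
    exact ⟨h₁, h₂, hdisj, fun s hs => hsign s hs _ rfl⟩
  · rintro ⟨h₁, h₂, hdisj, hsign⟩
    exact ⟨a.tail, h₁, h₂, hdisj, by simpa using hsign⟩

theorem before (h : B.IsTrail x (l₁ ++ a :: l₂) y) : B.IsTrail x l₁ a.tail :=
  (append_cons_iff.1 h).1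

theorem onward (h : B.IsTrail x (l₁ ++ a :: l₂) y) : B.IsTrail a.tail (a :: l₂) y :=
  (append_cons_iff.1 h).2.1

theorem through (h : B.IsTrail x (l₁ ++ a :: l₂) y) : B.IsTrail x (l₁ ++ [a]) a.head := by
  obtain ⟨h₁, -, hdisj, hsign⟩ := append_cons_iff.1 h
  exact append_cons_iff.2 ⟨h₁, singleton, fun e he he' => hdisj he (by simp_all), hsign⟩

theorem after (h : B.IsTrail x (l₁ ++ a :: l₂) y) :
    B.IsTrail a.head l₂ y ∧ a.edge ∉ l₂.map edge ∧ ∀ t ∈ departureSign l₂, t = -a.headSign := by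
  obtain ⟨z, h₁, h₂, hdisj, hsign⟩ := append_iff.1 (show B.IsTrail _ ([a] ++ l₂) y from h.onward)
  obtain rfl := h₁.walk.2
  exact ⟨h₂, fun ha => hdisj (by simp) ha, hsign _ rfl⟩

theorem edge_notMem_before (h : B.IsTrail x (l₁ ++ a :: l₂) y) : a.edge ∉ l₁.map edge :=
  fun ha => (append_cons_iff.1 h).2.2.1 ha (by simp)

theorem concat (h : B.IsTrail x l a.tail) (ha : a.edge ∉ l.map edge)
    (hs : ∀ s ∈ arrivalSign l, a.tailSign = -s) : B.IsTrail x (l ++ [a]) a.head :=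
  append_cons_iff.2 ⟨h, singleton, by simpa using ha, hs⟩

theorem head_eq_of_concat (h : B.IsTrail x (l ++ [a]) y) : a.head = y :=
  (IsDiwalk.concat_iff.1 h.walk).2

theorem reverse (h : B.IsTrail x l y) : B.IsTrail y (revSteps l) x := by
  induction l generalizing x with
  | nil => exact ⟨h.walk.symm, by simp [revSteps], by simp [revSteps]⟩
  | cons a l ih =>
    obtain rfl := h.walk.1
    obtain ⟨htail, ha, hsign⟩ := after (l₁ := []) h
    have hconcat : revSteps (a :: l) = revSteps l ++ [a.rev] := by simp [revSteps]
    rw [hconcat]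
    exact (ih htail).concat (by simpa using ha) fun s hs => by simp_all

theorem exists_eq_concat (h : B.IsTrail x l y) (hxy : x ≠ y) : ∃ l' a, l = l' ++ [a] :=
  (List.eq_nil_or_concat' l).resolve_left fun hl => hxy (hl ▸ h).walk

theorem exists_arrivalSign (h : B.IsTrail x l y) (hxy : x ≠ y) : ∃ s, arrivalSign l = some s := by
  obtain ⟨l', a, rfl⟩ := h.exists_eq_concat hxy
  exact ⟨a.headSign, by simp⟩

theorem exists_merge_of_notMem_before (hT : B.IsTrail r (l₁ ++ q :: l₂) v) (hQ : B.IsTrail w Q y)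
    (hq : q ∈ Q) (hl₁ : ∀ b ∈ l₁, b.edge ∉ Q.map edge) :
    ∃ P, P.map edge ⊆ (l₁ ++ q :: l₂).map edge ++ Q.map edge ∧ B.IsTrail r P y ∧
      arrivalSign P = arrivalSign Q := by
  obtain ⟨Q₁, Q₂, rfl⟩ := List.append_of_mem hq
  obtain ⟨hbefore, -, -, hsign⟩ := append_cons_iff.1 hT
  refine ⟨l₁ ++ q :: Q₂, fun e => ?_,
    append_cons_iff.2 ⟨hbefore, hQ.onward, fun e he he' => ?_, hsign⟩, by simp⟩
  · simp only [List.map_append, List.map_cons, List.mem_append, List.mem_cons]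
    tauto
  · obtain ⟨b, hb, rfl⟩ := List.mem_map.1 he
    exact hl₁ b hb (List.map_append ▸ List.mem_append_right _ he')

/-- `P` follows `T` up to the first edge shared with `Q` and continues along `Q` in whichever
direction `T` uses this edge. -/
theorem exists_merge (hT : B.IsTrail r T v) (hQ : B.IsTrail w Q y)
    (hTQ : ¬(T.map edge).Disjoint (Q.map edge)) :
    ∃ P, P.map edge ⊆ T.map edge ++ Q.map edge ∧
      (B.IsTrail r P y ∧ arrivalSign P = arrivalSign Q ∨
        B.IsTrail r P w ∧ arrivalSign P = departureSign Q) := by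
  classical
  obtain ⟨a, ha, haQ⟩ : ∃ a ∈ T, a.edge ∈ Q.map edge := by
    simpa [List.Disjoint] using hTQ
  obtain ⟨q, l₁, l₂, hl₁, hq, rfl, -⟩ :=
    List.exists_of_eraseP (p := fun a => a.edge ∈ Q.map edge) ha (by simpa using haQ)
  simp only [decide_eq_true_eq] at hl₁ hq
  obtain ⟨q', hq', hqq'⟩ := List.mem_map.1 hq
  rcases edge_eq_edge_iff.1 hqq'.symm with rfl | rfl
  · obtain ⟨P, hP, hPtrail⟩ := hT.exists_merge_of_notMem_before hQ hq' hl₁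
    exact ⟨P, hP, .inl hPtrail⟩
  · obtain ⟨P, hP, hPtrail, hsign⟩ :=
      hT.exists_merge_of_notMem_before hQ.reverse (mem_revSteps.2 hq') (by simpa using hl₁)
    exact ⟨P, by simpa [List.subset_def] using hP, .inr ⟨hPtrail, by simpa using hsign⟩⟩

end IsTrail

/-! ### Blossoms and their entrances -/

section Blossom

variable {r v w y : V}
  {a b f h h' : B.OrientedEdge} {l l₁ l₂ T : List B.OrientedEdge}

/-- Some trail starting in `r` has `a` as its last oriented edge. Unlike in `TrailReaches`, the
trail may pass through `r`; if `B` is edge-clean, it cannot. -/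
def Reached (r : V) (a : B.OrientedEdge) : Prop := ∃ l, B.IsTrail r (l ++ [a]) a.head

/-- Both orientations of `a` are reached from `r`. -/
def BiReached (r : V) (a : B.OrientedEdge) : Prop := Reached r a ∧ Reached r a.rev

/-- Of the two orientations of its edge, only `a` is reached from `r`. -/
def OneWay (r : V) (a : B.OrientedEdge) : Prop := Reached r a ∧ ¬Reached r a.rev

/-- The vertex `v` is incident with an edge both of whose orientations are reached from `r`. -/
def InBlossom (B : BidirectedGraph V E) (r v : V) : Prop :=
  ∃ a : B.OrientedEdge, BiReached r a ∧ a.head = v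

/-- Adjacency in the graph formed by the edges both of whose orientations are reached from `r`. -/
def BlossomAdj (B : BidirectedGraph V E) (r v w : V) : Prop :=
  ∃ a : B.OrientedEdge, BiReached r a ∧ a.tail = v ∧ a.head = w

/-- The component of `v` in the graph with adjacency relation `BlossomAdj B r`. -/
def blossom (B : BidirectedGraph V E) (r v : V) : Quot (B.BlossomAdj r) := Quot.mk _ v

/-- No nontrivial trail that starts in `r` ends in `r`. -/
def NoReturn (B : BidirectedGraph V E) (r : V) : Prop := ∀ l, B.IsTrail r l r → l = []

/-- Every trail from `r` to `v` uses the edge of `h`. -/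
def Dominates (r : V) (h : B.OrientedEdge) (v : V) : Prop :=
  ∀ T, B.IsTrail r T v → h.edge ∈ T.map edge

theorem IsTrail.reached (hl : B.IsTrail r l y) (ha : a ∈ l) : Reached r a := by
  obtain ⟨l₁, l₂, rfl⟩ := List.append_of_mem ha
  exact ⟨l₁, hl.through⟩

theorem NoReturn.head_ne (hr : B.NoReturn r) (ha : Reached r a) : a.head ≠ r := by
  rintro rfl
  obtain ⟨l, hl⟩ := ha
  exact List.append_ne_nil_of_right_ne_nil l (List.cons_ne_nil a []) (hr _ hl)

theorem NoReturn.not_inBlossom (hr : B.NoReturn r) : ¬B.InBlossom r r :=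
  fun ⟨_, ha, har⟩ => hr.head_ne ha.1 har

namespace BiReached

theorem rev (ha : BiReached r a) : BiReached r a.rev := ha.symm

theorem of_edge_eq (ha : BiReached r a) (hab : a.edge = b.edge) : BiReached r b := by
  rcases edge_eq_edge_iff.1 hab with rfl | rfl
  exacts [ha, ha.rev]

theorem blossom_eq (ha : BiReached r a) : B.blossom r a.tail = B.blossom r a.head :=
  Quot.sound ⟨a, ha, rfl, rfl⟩

theorem blossom_head_eq_of_edge_eq (ha : BiReached r a) (hab : a.edge = b.edge) :
    B.blossom r a.head = B.blossom r b.head := by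
  rcases edge_eq_edge_iff.1 hab with rfl | rfl
  exacts [rfl, ha.blossom_eq.symm]

end BiReached

theorem OneWay.eq_of_edge_eq (ha : OneWay r a) (hb : Reached r b) (hab : a.edge = b.edge) :
    a = b :=
  (edge_eq_edge_iff.1 hab).resolve_right fun h => ha.2 (h ▸ hb)

theorem OneWay.mem_of_edge_mem (hh : OneWay r h) (hT : B.IsTrail r T y)
    (hmem : h.edge ∈ T.map edge) : h ∈ T := by
  obtain ⟨a, ha, hah⟩ := List.mem_map.1 hmem
  exact hh.eq_of_edge_eq (hT.reached ha) hah.symm ▸ ha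

theorem blossom_induction {P : V → Prop} (hP : ∀ a : B.OrientedEdge, BiReached r a → P a.tail →
    P a.head) (hvw : B.blossom r v = B.blossom r w) (hv : P v) : P w := by
  have hlift : ∀ v w, B.BlossomAdj r v w → P v = P w := by
    rintro _ _ ⟨a, ha, rfl, rfl⟩
    exact propext ⟨hP a ha, hP a.rev ha.rev⟩
  exact (congrArg (Quot.lift P hlift) hvw).mp hv

theorem InBlossom.of_blossom_eq (hv : B.InBlossom r v) (hvw : B.blossom r v = B.blossom r w) :
    B.InBlossom r w :=
  blossom_induction (fun a ha _ => ⟨a, ha, rfl⟩) hvw hv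

theorem eq_of_blossom_eq (hv : ¬B.InBlossom r v) (hvw : B.blossom r v = B.blossom r w) : v = w :=
  blossom_induction (P := (v = ·)) (fun a ha hva => absurd ⟨a.rev, ha.rev, hva.symm⟩ hv) hvw rfl

theorem InBlossom.exists_arrivalSign_eq (hr : B.NoReturn r) (hv : B.InBlossom r v) (s : ℤˣ) :
    ∃ T, B.IsTrail r T v ∧ arrivalSign T = some s := by
  obtain ⟨a, ⟨⟨l, hl⟩, ⟨l', hl'⟩⟩, rfl⟩ := hv
  rcases eq_or_ne a.headSign s with has | has
  · exact ⟨_, hl, by simp [has]⟩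
  · obtain ⟨hbefore, -, -, hsign⟩ := IsTrail.append_cons_iff.1 hl'
    obtain ⟨t, ht⟩ := hbefore.exists_arrivalSign (hr.head_ne ⟨l, hl⟩).symm
    refine ⟨l', hbefore, ht.trans (congrArg some ?_)⟩
    exact neg_inj.1 ((hsign t ht).symm.trans (Int.units_ne_iff_eq_neg.1 has))

namespace OneWay

/-- Otherwise the trail could be continued along the reverse of `h`. -/
theorem edge_mem_of_arrivalSign (hh : OneWay r h) (hT : B.IsTrail r T h.head)
    (hsign : arrivalSign T = some (-h.headSign)) : h.edge ∈ T.map edge := by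
  by_contra hmem
  exact hh.2 ⟨T, hT.concat (a := h.rev) hmem (by simp [hsign])⟩

theorem arrivalSign_of_edge_notMem (hr : B.NoReturn r) (hh : OneWay r h)
    (hT : B.IsTrail r T h.head) (hmem : h.edge ∉ T.map edge) :
    arrivalSign T = some h.headSign := by
  obtain ⟨s, hs⟩ := hT.exists_arrivalSign (hr.head_ne hh.1).symm
  rw [hs, Option.some_inj]
  by_contra hne
  exact hmem (hh.edge_mem_of_arrivalSign hT (Int.units_ne_iff_eq_neg.1 hne ▸ hs))

theorem headSign_eq_of_head_eq (ha : OneWay r a) (hb : OneWay r b) (hab : a.head = b.head) :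
    a.headSign = b.headSign := by
  by_contra hne
  obtain ⟨l, hl⟩ := ha.1
  have hbl : b ∈ l := by
    have hmem := hb.mem_of_edge_mem hl <| hb.edge_mem_of_arrivalSign (hab ▸ hl)
      (by simp [Int.units_ne_iff_eq_neg.1 hne])
    exact (List.mem_append.1 hmem).resolve_right fun h => hne (List.mem_singleton.1 h ▸ rfl)
  obtain ⟨l₁, l₂, rfl⟩ := List.append_of_mem hbl
  have hal : a.edge ∈ (l₁ ++ [b]).map edge :=
    ha.edge_mem_of_arrivalSign (hab ▸ hl.before.through)
      (by simp [Int.units_ne_iff_eq_neg.1 (Ne.symm hne)])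
  refine hl.edge_notMem_before ?_
  simp only [List.map_append, List.mem_append, List.map_cons, List.mem_cons] at hal ⊢
  tauto

/-- A trail from `r` that arrives at the head of `h` with the sign opposite to that of `h` has used
`h` before; its part after `h` is the closed trail. -/
theorem exists_closed_trail (hr : B.NoReturn r) (hh : OneWay r h) (hb : B.InBlossom r h.head) :
    ∃ C, B.IsTrail h.head C h.head ∧ h.edge ∉ C.map edge ∧
      departureSign C = some (-h.headSign) ∧ arrivalSign C = some (-h.headSign) := by
  obtain ⟨T, hT, hsign⟩ := hb.exists_arrivalSign_eq hr (-h.headSign)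
  obtain ⟨T₁, C, rfl⟩ := List.append_of_mem
    (hh.mem_of_edge_mem hT (hh.edge_mem_of_arrivalSign hT hsign))
  obtain ⟨hC, hmem, hdep⟩ := hT.after
  cases C with
  | nil => simp [units_ne_neg_self] at hsign
  | cons c C =>
    refine ⟨c :: C, hC, hmem, congrArg some (hdep _ rfl), ?_⟩
    rwa [show T₁ ++ h :: c :: C = (T₁ ++ [h]) ++ c :: C by simp, arrivalSign_append_cons] at hsign

/-- A trail to the head of `h` that avoids `h` could be combined with the closed trail of
`exists_closed_trail` to a trail that avoids `h` and arrives with the opposite sign. -/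
theorem dominates_head (hr : B.NoReturn r) (hh : OneWay r h) (hb : B.InBlossom r h.head) :
    Dominates r h h.head := by
  intro T hT
  by_contra hmem
  obtain ⟨C, hC, hCmem, hdep, harr⟩ := hh.exists_closed_trail hr hb
  suffices ∃ P, P.map edge ⊆ T.map edge ++ C.map edge ∧ B.IsTrail r P h.head ∧
      arrivalSign P = some (-h.headSign) by
    obtain ⟨P, hP, hPtrail, hsign⟩ := this
    exact (List.mem_append.1 (hP (hh.edge_mem_of_arrivalSign hPtrail hsign))).elim hmem hCmem
  by_cases hdisj : (T.map edge).Disjoint (C.map edge)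
  · refine ⟨T ++ C, by simp, IsTrail.append_iff.2 ⟨_, hT, hC, hdisj, ?_⟩, ?_⟩
    · simp [hdep, hh.arrivalSign_of_edge_notMem hr hT hmem]
    · cases C with
      | nil => cases harr
      | cons c C => simpa using harr
  · obtain ⟨P, hP, ⟨hPtrail, hsign⟩ | ⟨hPtrail, hsign⟩⟩ := hT.exists_merge hC hdisj
    exacts [⟨P, hP, hPtrail, hsign.trans harr⟩, ⟨P, hP, hPtrail, hsign.trans hdep⟩]

end OneWay

namespace Dominates

theorem edge_mem_of_tail_of_mem (hd : Dominates r h a.tail) (hT : B.IsTrail r T y) (ha : a ∈ T) :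
    h.edge ∈ T.map edge := by
  obtain ⟨T₁, T₂, rfl⟩ := List.append_of_mem ha
  exact List.map_append ▸ List.mem_append_left _ (hd _ hT.before)

theorem edge_mem_of_head_of_mem (hd : Dominates r h a.head) (hT : B.IsTrail r T y) (ha : a ∈ T) :
    h.edge ∈ T.map edge := by
  obtain ⟨T₁, T₂, rfl⟩ := List.append_of_mem ha
  exact List.map_subset _ (by simp) (hd _ hT.through)

theorem arrivalSign_eq_headSign (hr : B.NoReturn r) (hf : Reached r f) (hfh : f.edge ≠ h.edge)
    (hd : Dominates r h f.tail) (hT : B.IsTrail r T f.head) (hmem : h.edge ∉ T.map edge) :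
    arrivalSign T = some f.headSign := by
  have hfT : f.edge ∉ T.map edge := by
    intro hfT
    obtain ⟨a, ha, haf⟩ := List.mem_map.1 hfT
    rcases edge_eq_edge_iff.1 haf with rfl | rfl
    exacts [hmem (hd.edge_mem_of_tail_of_mem hT ha), hmem (edge_mem_of_head_of_mem hd hT ha)]
  obtain ⟨s, hs⟩ := hT.exists_arrivalSign (hr.head_ne hf).symm
  rw [hs, Option.some_inj]
  by_contra hne
  have hrev := hd _ (hT.concat (a := f.rev) hfT (by simp [hs, Int.units_ne_iff_eq_neg.1 hne]))
  rw [List.map_append, List.mem_append] at hrev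
  exact hrev.elim hmem (by simpa using hfh.symm)

theorem exists_trail_from_head (hh : OneWay r h) (hf : BiReached r f) (hfh : f.edge ≠ h.edge)
    (hd : Dominates r h f.tail) :
    ∃ Q, B.IsTrail h.head Q f.head ∧ h.edge ∉ Q.map edge ∧
      ∀ s ∈ arrivalSign Q, s = -f.headSign := by
  obtain ⟨l, hl⟩ := hf.2
  have hhl : h ∈ l := (List.mem_append.1 (hh.mem_of_edge_mem hl (hd _ hl))).resolve_right
    fun hmem => hfh (List.mem_singleton.1 hmem ▸ rfl)
  obtain ⟨Q₁, Q, rfl⟩ := List.append_of_mem hhl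
  obtain ⟨hbefore, -, -, hsign⟩ := IsTrail.append_cons_iff.1 hl
  refine ⟨Q, hbefore.after.1, hbefore.after.2.1, fun s hs => ?_⟩
  cases Q with
  | nil => cases hs
  | cons q Q =>
    have hs' := hsign s
      (by rwa [show Q₁ ++ h :: q :: Q = (Q₁ ++ [h]) ++ q :: Q by simp, arrivalSign_append_cons])
    exact neg_eq_iff_eq_neg.1 hs'.symm

/-- A trail to the head of `f` that avoids `h` could be continued to the head of `h`, still avoiding
`h`, by going back along a trail that reaches the reverse of `f` through `h`. -/
theorem head_of_tail (hr : B.NoReturn r) (hh : OneWay r h) (hf : BiReached r f)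
    (hhead : Dominates r h h.head) (hd : Dominates r h f.tail) : Dominates r h f.head := by
  have hfh : f.edge ≠ h.edge := fun he => hh.2 (hf.of_edge_eq he).2
  obtain ⟨Q, hQ, hQmem, hQsign⟩ := exists_trail_from_head hh hf hfh hd
  intro T hT
  by_contra hmem
  by_cases hdisj : (T.map edge).Disjoint (Q.map edge)
  · have hP : B.IsTrail r (T ++ revSteps Q) h.head := by
      refine IsTrail.append_iff.2 ⟨_, hT, hQ.reverse, fun e he he' => hdisj he (by simpa using he'),
        ?_⟩
      simpa [arrivalSign_eq_headSign hr hf.1 hfh hd hT hmem] using hQsign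
    have hPmem := hhead _ hP
    rw [List.map_append, map_edge_revSteps, List.mem_append, List.mem_reverse] at hPmem
    exact hPmem.elim hmem hQmem
  · obtain ⟨P, hP, hPtrail⟩ := hT.exists_merge hQ hdisj
    have hPmem : h.edge ∉ P.map edge := fun he => (List.mem_append.1 (hP he)).elim hmem hQmem
    rcases hPtrail with ⟨hPtrail, hsign⟩ | ⟨hPtrail, -⟩
    · have hPsign := arrivalSign_eq_headSign hr hf.1 hfh hd hPtrail hPmem
      exact units_ne_neg_self _ (hQsign _ (hsign.symm.trans hPsign))
    · exact hPmem (hhead P hPtrail)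

end Dominates

namespace OneWay

theorem mem_of_blossom_eq (hr : B.NoReturn r) (hh : OneWay r h) (hb : B.InBlossom r h.head)
    (hv : B.blossom r h.head = B.blossom r v) (hT : B.IsTrail r T v) : h ∈ T := by
  have hhead := hh.dominates_head hr hb
  have hdom : Dominates r h v :=
    blossom_induction (fun f hf => Dominates.head_of_tail hr hh hf hhead) hv hhead
  exact hh.mem_of_edge_mem hT (hdom T hT)

/-- A blossom has only one entrance: if there were two, then each would have to be used before the
other. -/
theorem eq_of_blossom_eq (hr : B.NoReturn r) (hh : OneWay r h) (hh' : OneWay r h')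
    (hb : B.InBlossom r h.head) (hc : B.blossom r h.head = B.blossom r h'.head) : h = h' := by
  by_contra hne
  obtain ⟨l, hl⟩ := hh.1
  have hmem' : h' ∈ l := by
    have hmem := hh'.mem_of_blossom_eq hr (hb.of_blossom_eq hc) hc.symm hl
    exact (List.mem_append.1 hmem).resolve_right fun h => hne (List.mem_singleton.1 h).symm
  obtain ⟨l₁, l₂, rfl⟩ := List.append_of_mem hmem'
  have hmem : h ∈ l₁ :=
    (List.mem_append.1 (hh.mem_of_blossom_eq hr hb hc hl.before.through)).resolve_right
      fun h => hne (List.mem_singleton.1 h)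
  exact hl.edge_notMem_before (List.mem_map_of_mem (List.mem_append_left _ hmem))

theorem biReached_of_mem_after (hr : B.NoReturn r) (hh : OneWay r h) (hb : B.InBlossom r h.head)
    (hl : B.IsTrail r (l₁ ++ h :: l₂) v) (hv : B.blossom r h.head = B.blossom r v) :
    ∀ a ∈ l₂, BiReached r a ∧ B.blossom r h.head = B.blossom r a.head := by
  induction l₂ using List.reverseRecOn generalizing v with
  | nil => simp
  | append_singleton l a ih =>
    rw [← List.cons_append, ← List.append_assoc] at hl
    obtain rfl := hl.head_eq_of_concat
    have ha : Reached r a := hl.reached (by simp)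
    have hbi : BiReached r a := by
      refine ⟨ha, not_not.1 fun harev => hl.edge_notMem_before ?_⟩
      simp [hh.eq_of_blossom_eq hr ⟨ha, harev⟩ hb hv]
    rw [List.forall_mem_append, List.forall_mem_singleton]
    exact ⟨ih hl.before (hv.trans hbi.blossom_eq.symm), hbi, hv⟩

end OneWay

end Blossom

/-! ### Lifting directed paths -/

section Lift

variable {r v x y : V} {S : Set V}
  {a d : B.OrientedEdge} {l l' l₁ l₂ L L' K K₁ K₂ : List B.OrientedEdge}

/-- The oriented edges `l` are the steps of a trail from `x` to `y` that visits no vertex of `S`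
twice. Trails and paths are the extreme cases `S = ∅` and `S = Set.univ`. -/
structure IsSimpleTrail (B : BidirectedGraph V E) (S : Set V) (x : V) (l : List B.OrientedEdge)
    (y : V) : Prop extends B.IsTrail x l y where
  simple : (x :: l.map head).Pairwise fun u v => u ∈ S → u ≠ v

/-- Some trail that starts in `r` and visits no vertex of `S` twice has `a` as its last oriented
edge. -/
def SimplyReached (S : Set V) (r : V) (a : B.OrientedEdge) : Prop :=
  ∃ l, B.IsSimpleTrail S r (l ++ [a]) a.head

/-- Apart from steps in `l`, the oriented edges `L` only use edges inside those blossoms that a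
step of `l` enters. This is how trails in `B` are controlled by the dipaths in the graph of
blossoms. -/
def Follows (r : V) (l L : List B.OrientedEdge) : Prop :=
  ∀ a ∈ L, a ∈ l ∨ BiReached r a ∧ ∃ d ∈ l, B.blossom r d.head = B.blossom r a.head

theorem IsSimpleTrail.before (h : B.IsSimpleTrail S x (l₁ ++ a :: l₂) y) :
    B.IsSimpleTrail S x l₁ a.tail :=
  ⟨h.toIsTrail.before, h.simple.sublist (by simp)⟩

theorem SimplyReached.reached (h : SimplyReached S r a) : Reached r a :=
  h.imp fun _ hl => hl.toIsTrail

/-- In a blossom, `K` itself uses the entrance `d`. Outside the blossoms, `K` can be replaced by any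
other trail to `v`, as all of them arrive with the same sign. -/
theorem exists_isSimpleTrail_through (hr : B.NoReturn r) (hd : OneWay r d)
    (hdS : SimplyReached S r d) (hK : B.IsSimpleTrail S r K v)
    (hv : B.blossom r d.head = B.blossom r v) :
    ∃ K₁ K₂, B.IsSimpleTrail S r (K₁ ++ d :: K₂) v ∧ arrivalSign (d :: K₂) = arrivalSign K ∧
      ∀ a ∈ K₂, BiReached r a ∧ B.blossom r d.head = B.blossom r a.head := by
  by_cases hb : B.InBlossom r d.head
  · obtain ⟨K₁, K₂, rfl⟩ := List.append_of_mem (hd.mem_of_blossom_eq hr hb hv hK.toIsTrail)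
    exact ⟨K₁, K₂, hK, arrivalSign_append_cons.symm,
      hd.biReached_of_mem_after hr hb hK.toIsTrail hv⟩
  · obtain rfl := eq_of_blossom_eq hb hv
    obtain ⟨K', hK'⟩ := hdS
    obtain ⟨K, k, rfl⟩ := hK.exists_eq_concat (hr.head_ne hd.1).symm
    have hkd : k.head = d.head := hK.head_eq_of_concat
    have hk : Reached r k := hK.reached (by simp)
    have hkrev : ¬Reached r k.rev := fun hrev => hb ⟨k, ⟨hk, hrev⟩, hkd⟩
    exact ⟨K', [], hK', by simp [hd.headSign_eq_of_head_eq ⟨hk, hkrev⟩ hkd.symm], by simp⟩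

theorem IsSimpleTrail.append_cons (hr : B.NoReturn r) (hd : OneWay r d)
    (hL : B.IsSimpleTrail S r L d.tail) (hLd : ∀ a ∈ L, B.blossom r a.head ≠ B.blossom r d.head)
    (hK : B.IsSimpleTrail S r (K₁ ++ d :: K₂) v) (hsign : arrivalSign L = arrivalSign K₁)
    (hK₂ : ∀ a ∈ K₂, BiReached r a ∧ B.blossom r d.head = B.blossom r a.head) :
    B.IsSimpleTrail S r (L ++ d :: K₂) v := by
  have hblossom : ∀ a ∈ d :: K₂, B.blossom r d.head = B.blossom r a.head :=
    List.forall_mem_cons.2 ⟨rfl, fun a ha => (hK₂ a ha).2⟩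
  refine ⟨IsTrail.append_cons_iff.2 ⟨hL.toIsTrail, hK.onward, ?_, ?_⟩, ?_⟩
  · intro e he he'
    obtain ⟨a, ha, rfl⟩ := List.mem_map.1 he
    obtain ⟨b, hb, hba⟩ := List.mem_map.1 he'
    refine hLd a ha ?_
    rcases List.mem_cons.1 hb with rfl | hb
    · rw [hd.eq_of_edge_eq (hL.reached ha) hba]
    · rw [(hK₂ b hb).2, (hK₂ b hb).1.blossom_head_eq_of_edge_eq hba]
  · exact hsign ▸ (IsTrail.append_cons_iff.1 hK.toIsTrail).2.2.2
  · rw [List.map_append, ← List.cons_append, List.pairwise_append]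
    refine ⟨hL.simple, hK.simple.sublist (by simp), ?_⟩
    rintro u hu _ hw - rfl
    obtain ⟨b, hb, rfl⟩ := List.mem_map.1 hw
    rcases List.mem_cons.1 hu with hbr | hu
    · exact hr.head_ne (hK.reached (List.mem_append_right _ hb)) hbr
    · obtain ⟨a, ha, hab⟩ := List.mem_map.1 hu
      exact hLd a ha (by rw [hab, hblossom b hb])

namespace Follows

theorem blossom_ne (hL : Follows r l L) (hl : ∀ a ∈ l, B.blossom r a.head ≠ B.blossom r d.head) :
    ∀ a ∈ L, B.blossom r a.head ≠ B.blossom r d.head := fun a ha => by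
  rcases hL a ha with h | ⟨-, b, hb, hba⟩
  exacts [hl a h, hba ▸ hl b hb]

theorem append_cons (hL : Follows r l L)
    (hK₂ : ∀ a ∈ K₂, BiReached r a ∧ B.blossom r d.head = B.blossom r a.head) :
    Follows r (l ++ [d]) (L ++ d :: K₂) := by
  refine List.forall_mem_append.2 ⟨fun a ha => (hL a ha).imp (List.mem_append_left _) ?_,
    List.forall_mem_cons.2 ⟨.inl (by simp), fun a ha => .inr ⟨(hK₂ a ha).1, d, by simp, ?_⟩⟩⟩
  · exact fun ⟨h, b, hb, hba⟩ => ⟨h, b, List.mem_append_left _ hb, hba⟩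
  · exact (hK₂ a ha).2

theorem disjoint_map_edge (hr : B.NoReturn r) (hl : ∀ d ∈ l, OneWay r d)
    (hl' : ∀ d ∈ l', OneWay r d) (hdisj : l.Disjoint l') (hL : Follows r l L)
    (hL' : Follows r l' L') : (L.map edge).Disjoint (L'.map edge) := by
  intro e he he'
  obtain ⟨a, ha, rfl⟩ := List.mem_map.1 he
  obtain ⟨b, hb, hba⟩ := List.mem_map.1 he'
  rcases hL a ha with hal | ⟨ha, d, hd, hda⟩ <;> rcases hL' b hb with hbl' | ⟨hb, d', hd', hdb⟩
  · exact hdisj hal ((hl a hal).eq_of_edge_eq (hl' b hbl').1 hba.symm ▸ hbl')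
  · exact (hl a hal).2 (hb.of_edge_eq hba).2
  · exact (hl' b hbl').2 (ha.of_edge_eq hba.symm).2
  · have hdd' : B.blossom r d.head = B.blossom r d'.head := by
      rw [hda, hdb, hb.blossom_head_eq_of_edge_eq hba]
    have hdb : B.InBlossom r d.head := InBlossom.of_blossom_eq ⟨a, ha, rfl⟩ hda.symm
    exact hdisj hd ((hl d hd).eq_of_blossom_eq hr (hl' d' hd') hdb hdd' ▸ hd')

end Follows

/-- The trail `K` only prescribes the sign with which `L` arrives, which is what the induction
needs: the `L` found for the initial part of `l` has to be continued along the last arc of `l`. -/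
theorem exists_isSimpleTrail_follows (hr : B.NoReturn r)
    (hl : IsDipath (B.blossom r ∘ tail) (B.blossom r ∘ head)
      {a | SimplyReached S r a ∧ ¬Reached r a.rev} (B.blossom r r) l (B.blossom r v))
    (hK : B.IsSimpleTrail S r K v) :
    ∃ L, B.IsSimpleTrail S r L v ∧ arrivalSign L = arrivalSign K ∧ Follows r l L := by
  induction l using List.reverseRecOn generalizing K v with
  | nil =>
    obtain rfl := eq_of_blossom_eq hr.not_inBlossom hl.walk
    exact ⟨K, hK, rfl, by simp [Follows, hr _ hK.toIsTrail]⟩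
  | append_singleton l d ih =>
    obtain ⟨hdS, hdrev⟩ := hl.mem d (by simp)
    have hd : OneWay r d := ⟨hdS.reached, hdrev⟩
    obtain ⟨hwalk, hdv⟩ := IsDiwalk.concat_iff.1 hl.walk
    obtain ⟨K₁, K₂, hK', hsign, hK₂⟩ := exists_isSimpleTrail_through hr hd hdS hK hdv
    obtain ⟨L, hL, hLsign, hLl⟩ := ih
      ⟨hwalk, hl.nodup.sublist (by simp), fun a ha => hl.mem a (by simp [ha])⟩ hK'.before
    have hnew : ∀ a ∈ l, B.blossom r a.head ≠ B.blossom r d.head := by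
      have hnodup := (List.nodup_cons.1 hl.nodup).2
      rw [List.map_append, List.nodup_append'] at hnodup
      exact fun a ha had => hnodup.2.2 (List.mem_map_of_mem ha) (by simp [had])
    exact ⟨L ++ d :: K₂, hL.append_cons hr hd (hLl.blossom_ne hnew) hK' hLsign hK₂,
      arrivalSign_append_cons.trans hsign, hLl.append_cons hK₂⟩

/-- The edges with an orientation that enters `X` and is the last step of a trail from `r` that
visits no vertex of `S` twice. The path cut is the case `S = Set.univ`. -/
def simpleCut (B : BidirectedGraph V E) (S : Set V) (r : V) (X : Set V) : Set E :=
  {e | ∃ a : B.OrientedEdge, a.edge = e ∧ a.head ∈ X ∧ a.tail ∉ X ∧ SimplyReached S r a}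

theorem ncard_simpleCut_preimage_blossom_le [Finite E] (X : Set (Quot (B.BlossomAdj r))) :
    (B.simpleCut S r (B.blossom r ⁻¹' X)).ncard ≤
      {a ∈ {a : B.OrientedEdge | SimplyReached S r a ∧ ¬Reached r a.rev} |
        (B.blossom r ∘ tail) a ∉ X ∧ (B.blossom r ∘ head) a ∈ X}.ncard := by
  refine (Set.ncard_le_ncard ?_ (Set.toFinite _)).trans
    (Set.ncard_image_le (f := edge) (Set.toFinite _))
  rintro e ⟨a, rfl, hhead, htail, ha⟩
  refine ⟨a, ⟨⟨ha, fun hrev => htail ?_⟩, htail, hhead⟩, rfl⟩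
  rwa [Set.mem_preimage, BiReached.blossom_eq ⟨ha.reached, hrev⟩]

theorem exists_pairwise_disjoint_isSimpleTrail [Finite E] (hr : B.NoReturn r) (hx : x ≠ r)
    (S : Set V) :
    ∃ (k : ℕ) (X : Set V) (L : Fin k → List B.OrientedEdge), x ∈ X ∧ r ∉ X ∧
      (B.simpleCut S r X).ncard ≤ k ∧ (∀ i, B.IsSimpleTrail S r (L i) x) ∧
      Pairwise fun i j => ((L i).map edge).Disjoint ((L j).map edge) := by
  by_cases hex : ∃ K, B.IsSimpleTrail S r K x
  · obtain ⟨K, hK⟩ := hex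
    obtain ⟨k, f, X, hf, hdisj, hxX, hrX, hcut⟩ := exists_pairwise_disjoint_isDipath_and_cut
      (B.blossom r ∘ tail) (B.blossom r ∘ head)
      (Set.toFinite {a : B.OrientedEdge | SimplyReached S r a ∧ ¬Reached r a.rev})
      fun hrx => hx (eq_of_blossom_eq hr.not_inBlossom hrx).symm
    have honeWay : ∀ i, ∀ d ∈ f i, OneWay r d := fun i d hd =>
      ((hf i).mem d hd).imp_left SimplyReached.reached
    choose L hL _ hfollows using fun i => exists_isSimpleTrail_follows hr (hf i) hK
    exact ⟨k, B.blossom r ⁻¹' X, L, hxX, hrX, hcut ▸ ncard_simpleCut_preimage_blossom_le X, hL,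
      fun i j hij => (hfollows i).disjoint_map_edge hr (honeWay i) (honeWay j) (hdisj hij)
        (hfollows j)⟩
  · have hcut : B.simpleCut S r {x} = ∅ := Set.eq_empty_iff_forall_notMem.2 <| by
      rintro e ⟨a, -, rfl, -, l, hl⟩
      exact hex ⟨_, hl⟩
    exact ⟨0, {x}, Fin.elim0, rfl, hx.symm, by simp [hcut], (·.elim0), (·.elim0)⟩

end Lift

/-! ### Packings and separating edge sets -/

section Packing

variable {r x y : V} {S : Set V}
  {a : B.OrientedEdge} {l : List B.OrientedEdge} {F : Set E} {X : Set V}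

/-- The trail visits no vertex of `S` twice. This interpolates between trails, for `S = ∅`, and
paths, for `S = Set.univ`. -/
def Trail.IsSimpleOn (S : Set V) (T : B.Trail x y) : Prop :=
  T.vertices.Pairwise fun u v => u ∈ S → u ≠ v

theorem Trail.isSimpleOn_univ (T : B.Trail x y) : T.IsSimpleOn Set.univ ↔ T.IsPath := by
  simp [IsSimpleOn, IsPath, List.Nodup]

theorem Trail.isSimpleOn_empty (T : B.Trail x y) : T.IsSimpleOn ∅ := by
  simp [IsSimpleOn, List.pairwise_of_forall]

theorem joins_iff_isDiwalk : B.Joins x l y ↔ IsDiwalk tail head x l y := by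
  induction l generalizing x with
  | nil => rfl
  | cons a l ih => simp [Joins, IsDiwalk, ih]

theorem Trail.isTrail (T : B.Trail x y) : B.IsTrail x T.steps y :=
  ⟨joins_iff_isDiwalk.1 T.joins, T.edges_nodup, T.alternating⟩

/-- The trail with a given list of steps. -/
def IsTrail.toTrail (h : B.IsTrail x l y) : B.Trail x y :=
  ⟨l, joins_iff_isDiwalk.2 h.walk, h.nodup, h.chain⟩

theorem Trail.IsSimpleOn.isSimpleTrail {T : B.Trail x y} (hT : T.IsSimpleOn S) :
    B.IsSimpleTrail S x T.steps y :=
  ⟨T.isTrail, hT⟩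

theorem simplyReached_univ_iff : SimplyReached Set.univ r a ↔ B.PathReaches r a := by
  constructor
  · rintro ⟨l, hl⟩
    exact ⟨hl.toTrail, (Trail.isSimpleOn_univ _).1 hl.simple,
      by simp [Trail.EndsWith, IsTrail.toTrail]⟩
  · rintro ⟨T, hT, ha⟩
    obtain ⟨l, hl⟩ := List.getLast?_eq_some_iff.1 ha
    exact ⟨l, hl ▸ ((Trail.isSimpleOn_univ T).2 hT).isSimpleTrail⟩

theorem simpleCut_univ : B.simpleCut Set.univ r X = B.pathCut r X := by
  simp only [simpleCut, pathCut, simplyReached_univ_iff]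

/-- The first return of a trail to `r` would make its last edge undirectable, as this edge alone
is an `r`-trail in the other direction. -/
theorem EdgeClean.noReturn (h : B.EdgeClean r) : B.NoReturn r := by
  classical
  intro l hl
  by_contra hne
  obtain ⟨a, ha, har⟩ : ∃ a ∈ l, a.head = r := by
    obtain rfl | ⟨l', a, rfl⟩ := List.eq_nil_or_concat' l
    exacts [absurd rfl hne, ⟨a, by simp, hl.head_eq_of_concat⟩]
  obtain ⟨b, l₁, l₂, hl₁, hbr, rfl, -⟩ :=
    List.exists_of_eraseP (p := fun a => a.head = r) ha (by simpa using har)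
  simp only [decide_eq_true_eq] at hl₁ hbr
  subst hbr
  refine h b.edge (fun c hc => ?_) (b.ends_eq ▸ Sym2.mem_mk_right _ _)
  rcases edge_eq_edge_iff.1 hc with rfl | rfl
  · exact ⟨hl.through.toTrail, by simpa [Trail.IsRootTrail, IsTrail.toTrail] using hl₁,
      by simp [Trail.EndsWith, IsTrail.toTrail]⟩
  · exact ⟨(IsTrail.singleton (a := b.rev)).toTrail,
      by simp [Trail.IsRootTrail, IsTrail.toTrail], by simp [Trail.EndsWith, IsTrail.toTrail]⟩

/-- An oriented edge of `B - F` as an oriented edge of `B`. -/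
def OrientedEdge.ofDelete (a : (B.deleteEdges F).OrientedEdge) : B.OrientedEdge :=
  ⟨a.edge, a.tail, a.head, a.ends_eq⟩

theorem range_ofDelete : Set.range (ofDelete (B := B) (F := F)) = {a | a.edge ∉ F} :=
  Set.Subset.antisymm (by rintro _ ⟨a, rfl⟩; exact a.edge.2)
    fun a ha => ⟨⟨⟨a.edge, ha⟩, a.tail, a.head, a.ends_eq⟩, rfl⟩

theorem isSimpleTrail_map_ofDelete {l : List (B.deleteEdges F).OrientedEdge} :
    B.IsSimpleTrail S x (l.map ofDelete) y ↔ (B.deleteEdges F).IsSimpleTrail S x l y := by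
  have hwalk : IsDiwalk tail head x (l.map (ofDelete (B := B))) y ↔ IsDiwalk tail head x l y :=
    IsDiwalk.map_iff
  have hnodup : ((l.map (ofDelete (B := B))).map edge).Nodup ↔ (l.map edge).Nodup := by
    rw [← List.nodup_map_iff (l := l.map edge) Subtype.val_injective, List.map_map, List.map_map]
    rfl
  have hchain : (l.map (ofDelete (B := B))).IsChain (fun a b => b.tailSign = -a.headSign) ↔
      l.IsChain fun a b => b.tailSign = -a.headSign := List.isChain_map _
  have hhead : (l.map (ofDelete (B := B))).map head = l.map head := List.map_map
  exact ⟨fun h => ⟨⟨hwalk.1 h.walk, hnodup.1 h.nodup, hchain.1 h.chain⟩, hhead ▸ h.simple⟩,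
    fun h => ⟨⟨hwalk.2 h.walk, hnodup.2 h.nodup, hchain.2 h.chain⟩, hhead ▸ h.simple⟩⟩

theorem exists_mem_edgeSet_of_forall_not_isSimpleOn
    (hF : ¬∃ T : (B.deleteEdges F).Trail r x, T.IsSimpleOn S) {T : B.Trail r x}
    (hT : T.IsSimpleOn S) : ∃ e ∈ F, e ∈ T.edgeSet := by
  by_contra! hmem
  obtain ⟨l, hl⟩ : T.steps ∈ Set.range (List.map (ofDelete (B := B) (F := F))) := by
    rw [Set.range_list_map, range_ofDelete]
    exact fun a ha haF => hmem _ haF (List.mem_map_of_mem ha)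
  have hsimple := isSimpleTrail_map_ofDelete.1 (hl ▸ hT.isSimpleTrail)
  exact hF ⟨hsimple.toTrail, hsimple.simple⟩

theorem card_le_ncard_of_forall_not_isSimpleOn [Finite E] {P : Finset (B.Trail r x)}
    (hP : ∀ T ∈ P, T.IsSimpleOn S)
    (hdisj : (P : Set (B.Trail r x)).Pairwise fun T T' => Disjoint T.edgeSet T'.edgeSet)
    (hF : ¬∃ T : (B.deleteEdges F).Trail r x, T.IsSimpleOn S) : P.card ≤ F.ncard := by
  choose e heF heT using fun T : P =>
    exists_mem_edgeSet_of_forall_not_isSimpleOn hF (hP T T.2)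
  have hinj : Function.Injective fun T => (⟨e T, heF T⟩ : F) := by
    intro T T' hTT'
    by_contra hne
    have hee : e T = e T' := congrArg Subtype.val hTT'
    exact Set.disjoint_left.1 (hdisj T.2 T'.2 (Subtype.coe_ne_coe.2 hne)) (heT T) (hee ▸ heT T')
  simpa using Nat.card_le_card_of_injective _ hinj

theorem IsSimpleTrail.exists_simplyReached_entering (hl : B.IsSimpleTrail S r l x) (hx : x ∈ X)
    (hr : r ∉ X) : ∃ a ∈ l, a.head ∈ X ∧ a.tail ∉ X ∧ SimplyReached S r a := by
  induction l using List.reverseRecOn generalizing x with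
  | nil => exact absurd (hl.walk ▸ hx) hr
  | append_singleton l a ih =>
    obtain rfl := hl.head_eq_of_concat
    by_cases ha : a.tail ∈ X
    · obtain ⟨b, hb, hbX⟩ := ih hl.before ha
      exact ⟨b, List.mem_append_left _ hb, hbX⟩
    · exact ⟨a, by simp, hx, ha, l, hl⟩

theorem not_isSimpleOn_deleteEdges_simpleCut (hx : x ∈ X) (hr : r ∉ X) :
    ¬∃ T : (B.deleteEdges (B.simpleCut S r X)).Trail r x, T.IsSimpleOn S := by
  rintro ⟨T, hT⟩
  obtain ⟨a, ha, haX⟩ := IsSimpleTrail.exists_simplyReached_entering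
    (isSimpleTrail_map_ofDelete.2 hT.isSimpleTrail) hx hr
  obtain ⟨b, -, rfl⟩ := List.mem_map.1 ha
  exact b.edge.2 ⟨_, rfl, haX⟩

/-- The sizes of the finite families of pairwise edge-disjoint `r`–`x` trails that visit no vertex
of `S` twice. -/
def simplePackingSizes (B : BidirectedGraph V E) (S : Set V) (r x : V) : Set ℕ :=
  {k | ∃ P : Finset (B.Trail r x), (∀ T ∈ P, T.IsSimpleOn S) ∧
    (P : Set (B.Trail r x)).Pairwise (fun T T' => Disjoint T.edgeSet T'.edgeSet) ∧ P.card = k}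

theorem simplePackingSizes_univ : B.simplePackingSizes Set.univ r x = B.pathPackingSizes r x := by
  simp only [simplePackingSizes, pathPackingSizes, Trail.isSimpleOn_univ]

theorem simplePackingSizes_empty : B.simplePackingSizes ∅ r x = B.trailPackingSizes r x := by
  simp [simplePackingSizes, trailPackingSizes, Trail.isSimpleOn_empty]

theorem mem_simplePackingSizes (hx : x ≠ r) {k : ℕ} {L : Fin k → List B.OrientedEdge}
    (hL : ∀ i, B.IsSimpleTrail S r (L i) x)
    (hdisj : Pairwise fun i j => ((L i).map edge).Disjoint ((L j).map edge)) :
    k ∈ B.simplePackingSizes S r x := by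
  classical
  have hinj : Function.Injective fun i => (hL i).toTrail := by
    intro i j hij
    by_contra hne
    obtain ⟨l, a, hl⟩ := (hL i).exists_eq_concat hx.symm
    have hLij : L i = L j := congrArg Trail.steps hij
    exact hdisj hne (a := a.edge) (by simp [hl]) (by simp [← hLij, hl])
  refine ⟨Finset.univ.image fun i => (hL i).toTrail, ?_, ?_, ?_⟩
  · exact Finset.forall_mem_image.2 fun i _ => (hL i).simple
  · rw [Finset.coe_image, Finset.coe_univ, Set.image_univ]
    rintro _ ⟨i, rfl⟩ _ ⟨j, rfl⟩ hij
    exact Set.disjoint_left.2 (hdisj fun h => hij (h ▸ rfl))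
  · rw [Finset.card_image_of_injective _ hinj, Finset.card_fin]

end Packing

end BidirectedGraph

open BidirectedGraph

theorem mainTheorem3_general {V : Type u} {E : Type v} [Finite E] (B : BidirectedGraph V E)
    (S : Set V) (r x : V) (hx : x ≠ r) (hclean : B.EdgeClean r) :
    ∃ k : ℕ, IsGreatest (B.simplePackingSizes S r x) k ∧
      IsLeast {n : ℕ | ∃ X : Set V, x ∈ X ∧ r ∉ X ∧ (B.simpleCut S r X).ncard = n} k ∧
      IsLeast {n : ℕ | ∃ F : Set E,
        (¬∃ T : (B.deleteEdges F).Trail r x, T.IsSimpleOn S) ∧ F.ncard = n} k := by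
  obtain ⟨k, X, L, hxX, hrX, hcut, hL, hdisj⟩ :=
    exists_pairwise_disjoint_isSimpleTrail hclean.noReturn hx S
  have hk := mem_simplePackingSizes hx hL hdisj
  have hle : ∀ n ∈ B.simplePackingSizes S r x, ∀ F : Set E,
      (¬∃ T : (B.deleteEdges F).Trail r x, T.IsSimpleOn S) → n ≤ F.ncard := by
    rintro _ ⟨P, hP, hPdisj, rfl⟩ F hF
    exact card_le_ncard_of_forall_not_isSimpleOn hP hPdisj hF
  have hsep := not_isSimpleOn_deleteEdges_simpleCut (B := B) (S := S) hxX hrX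
  have hcut_eq : (B.simpleCut S r X).ncard = k := hcut.antisymm (hle k hk _ hsep)
  refine ⟨k, ⟨hk, fun n hn => (hle n hn _ hsep).trans hcut⟩, ⟨⟨X, hxX, hrX, hcut_eq⟩, ?_⟩,
    ⟨⟨_, hsep, hcut_eq⟩, ?_⟩⟩
  · rintro _ ⟨Y, hxY, hrY, rfl⟩
    exact hle k hk _ (not_isSimpleOn_deleteEdges_simpleCut hxY hrY)
  · rintro _ ⟨F, hF, rfl⟩
    exact hle k hk F hF

theorem mainTheorem3 {V : Type u} {E : Type v} [Finite V] [Finite E]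
    (B : BidirectedGraph V E) (r x : V) (hx : x ≠ r) (hclean : B.EdgeClean r) :
    (∃ k : ℕ,
      IsGreatest (B.pathPackingSizes r x) k ∧
      IsLeast {n : ℕ | ∃ X : Set V, x ∈ X ∧ r ∉ X ∧ (B.pathCut r X).ncard = n} k ∧
      IsLeast {n : ℕ | ∃ F : Set E,
        (¬ ∃ T : (B.deleteEdges F).Trail r x, T.IsPath) ∧ F.ncard = n} k) ∧
    (∃ k : ℕ,
      IsGreatest (B.trailPackingSizes r x) k ∧
      IsLeast {n : ℕ | ∃ F : Set E,
        IsEmpty ((B.deleteEdges F).Trail r x) ∧ F.ncard = n} k) := by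
  constructor
  · simpa only [simplePackingSizes_univ, simpleCut_univ, Trail.isSimpleOn_univ] using
      mainTheorem3_general B Set.univ r x hx hclean
  · obtain ⟨k, hgreatest, -, hleast⟩ := mainTheorem3_general B ∅ r x hx hclean
    exact ⟨k, by simpa only [simplePackingSizes_empty] using hgreatest,
      by simpa only [Trail.isSimpleOn_empty, exists_true_iff_nonempty, not_nonempty_iff]
        using hleast⟩
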